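/- For $\lambda\in\mathbb C$, $n\in\mathbb N_0$ let $(\lambda)_n=\lambda(\lambda+1)\cdots(\lambda+n-1)$ (with $(\lambda)_0=1$), let $B(u,v)=\Gamma(u)\Gamma(v)/\Gamma(u+v)$, let $K_\alpha$ be the modified Bessel function of the second kind, $K_\alpha(w)=\int_0^\infty e^{-w\cosh u}\cosh(\alpha u)\,du$ for $\operatorname{Re} w>0$, and for $\operatorname{Re} p>0$, $\nu\ge 0$ let $$B_{p,\nu}(u,v)=\sqrt{\frac{2p}{\pi}}\int_0^1 t^{u-3/2}(1-t)^{v-3/2}K_{\nu+1/2}\!\left(\frac{p}{t(1-t)}\right)dt .$$ Put $$H_{B,p,\nu}(b_1,b_2,b_3;c_1,c_2,c_3;x,y,z)=\sum_{m,n,k=0}^\infty \frac{(b_1+b_2)_{2m+n+k}(b_3)_{n+k}}{(c_1)_m(c_2)_n(c_3)_k}\,\frac{B_{p,\nu}(b_1+m+k,\,b_2+m+n)}{B(b_1,b_2)}\,\frac{x^m}{m!}\frac{y^n}{n!}\frac{z^k}{k!},$$ $$H_B^{(a)}(b_1,b_2,b_3;c_1,c_2,c_3;x,y,z)=\sum_{m,n,k=0}^\infty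 \frac{(b_1+b_2)_{2m+n+k}(b_3)_{n+k}}{(c_1)_m(c_2)_n(c_3)_k}\,\frac{B(b_1+a+m+k,\,b_2+a+m+n)}{B(b_1,b_2)}\,\frac{x^m}{m!}\frac{y^n}{n!}\frac{z^k}{k!}.$$ **Theorem.** Let $\nu\in\mathbb R$ and $s,b_1,b_2,b_3,c_1,c_2,c_3,x,y,z\in\mathbb C$ with $\operatorname{Re} s>\nu>0$, where $c_1,c_2,c_3$ and $b_1,b_2,b_1+b_2$ are not in $\{0,-1,-2,\dots\}$ and $\operatorname{Re}(b_1+s)>0$, $\operatorname{Re}(b_2+s)>0$ (these conditions on $b_1,b_2$ all hold if $\operatorname{Re} b_1,\operatorname{Re} b_2>0$). Let $|x|<r_1$, $|y|<r_2$, $|z|<r_3$ for some real $r_1,r_2,r_3$ with $r_1+r_2+r_3+2\sqrt{r_1r_2r_3}=1$. Then the series defining $H_{B,p,\nu}(b_1,b_2,b_3;c_1,c_2,c_3;x,y,z)$ for each real $p>0$, and the one defining $H_B^{(s)}(b_1,b_2,b_3;c_1,c_2,c_3;x,y,z)$, converge absolutely, the Mellin integral below converges absolutely, and $$\int_0^\infty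 p^{s-1}H_{B,p,\nu}(b_1,b_2,b_3;c_1,c_2,c_3;x,y,z)\,dp=\frac{2^{s-1}}{\sqrt\pi}\,\Gamma\!\left(\frac{s-\nu}{2}\right)\Gamma\!\left(\frac{s+\nu+1}{2}\right)H_B^{(s)}(b_1,b_2,b_3;c_1,c_2,c_3;x,y,z).$$ -/

import Mathlib

open MeasureTheory Set

namespace SrivastavaHB

/-- The Pochhammer symbol `(l)_n = l (l + 1) ⋯ (l + n - 1)`, with `(l)_0 = 1`. -/
noncomputable def poch (l : ℂ) (n : ℕ) : ℂ := (ascPochhammer ℂ n).eval l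

/-- The classical Beta function `B(u, v) = Γ(u) Γ(v) / Γ(u + v)` (for `u`, `v` not in
`{0, -1, -2, …}`). -/
noncomputable def beta (u v : ℂ) : ℂ :=
  Complex.Gamma u * Complex.Gamma v / Complex.Gamma (u + v)

/-- For `Re u, Re v > 0` the function `beta` is Euler's integral
`∫_0^1 t^(u-1) (1-t)^(v-1) dt`. -/
theorem beta_eq_betaIntegral {u v : ℂ} (hu : 0 < u.re) (hv : 0 < v.re) :
    beta u v = Complex.betaIntegral u v := by
  have h : Complex.Gamma (u + v) ≠ 0 := by
    apply Complex.Gamma_ne_zero_of_re_pos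
    rw [Complex.add_re]
    exact add_pos hu hv
  rw [beta, Complex.Gamma_mul_Gamma_eq_betaIntegral hu hv, mul_div_cancel_left₀ _ h]

/-- The modified Bessel function of the second kind (Macdonald function) of order `α`, for
`Re w > 0`: `K_α(w) = ∫_0^∞ exp(-w cosh u) cosh(α u) du`. -/
noncomputable def besselK (α w : ℂ) : ℂ :=
  ∫ u in Ioi (0 : ℝ), Complex.exp (-w * Complex.cosh (u : ℂ)) * Complex.cosh (α * (u : ℂ))

/-- The extended Beta function, for `Re p > 0`:
`B_{p,ν}(u, v) = √(2p/π) ∫_0^1 t^(u-3/2) (1-t)^(v-3/2) K_{ν+1/2}(p / (t (1-t))) dt`. -/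
noncomputable def extBeta (p : ℂ) (ν : ℝ) (u v : ℂ) : ℂ :=
  (2 * p / (Real.pi : ℂ)) ^ (1 / 2 : ℂ) *
    ∫ t in (0 : ℝ)..1, (t : ℂ) ^ (u - 3 / 2) * (1 - (t : ℂ)) ^ (v - 3 / 2) *
      besselK ((ν : ℂ) + 1 / 2) (p / ((t : ℂ) * (1 - (t : ℂ))))

/-- The `(m, n, k)`-th term of the triple series
`∑ (b₁+b₂)_{2m+n+k} (b₃)_{n+k} / ((c₁)_m (c₂)_n (c₃)_k)
  * (F(b₁+m+k, b₂+m+n) / B(b₁, b₂)) * x^m/m! * y^n/n! * z^k/k!`,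
in which `F` is the (extended or shifted) Beta function. -/
noncomputable def term (F : ℂ → ℂ → ℂ) (b₁ b₂ b₃ c₁ c₂ c₃ x y z : ℂ) (m n k : ℕ) : ℂ :=
  poch (b₁ + b₂) (2 * m + n + k) * poch b₃ (n + k) / (poch c₁ m * poch c₂ n * poch c₃ k) *
    (F (b₁ + m + k) (b₂ + m + n) / beta b₁ b₂) *
    (x ^ m / (m.factorial : ℂ)) * (y ^ n / (n.factorial : ℂ)) * (z ^ k / (k.factorial : ℂ))

/-- The term of the series `H_{B,p,ν}(b₁,b₂,b₃; c₁,c₂,c₃; x,y,z)`. -/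
noncomputable def extHBTerm (p : ℂ) (ν : ℝ) (b₁ b₂ b₃ c₁ c₂ c₃ x y z : ℂ)
    (i : ℕ × ℕ × ℕ) : ℂ :=
  term (extBeta p ν) b₁ b₂ b₃ c₁ c₂ c₃ x y z i.1 i.2.1 i.2.2

/-- The `(p,ν)`-extended Srivastava function `H_{B,p,ν}(b₁,b₂,b₃; c₁,c₂,c₃; x,y,z)`. -/
noncomputable def extHB (p : ℂ) (ν : ℝ) (b₁ b₂ b₃ c₁ c₂ c₃ x y z : ℂ) : ℂ :=
  ∑' i : ℕ × ℕ × ℕ, extHBTerm p ν b₁ b₂ b₃ c₁ c₂ c₃ x y z i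

/-- The term of the series `H_B^{(a)}(b₁,b₂,b₃; c₁,c₂,c₃; x,y,z)`, in which both arguments of
the Beta function in the numerator are shifted by `a`. -/
noncomputable def shiftHBTerm (a b₁ b₂ b₃ c₁ c₂ c₃ x y z : ℂ) (i : ℕ × ℕ × ℕ) : ℂ :=
  term (fun u v => beta (u + a) (v + a)) b₁ b₂ b₃ c₁ c₂ c₃ x y z i.1 i.2.1 i.2.2

/-- The function `H_B^{(a)}(b₁,b₂,b₃; c₁,c₂,c₃; x,y,z)`. -/
noncomputable def shiftHB (a b₁ b₂ b₃ c₁ c₂ c₃ x y z : ℂ) : ℂ :=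
  ∑' i : ℕ × ℕ × ℕ, shiftHBTerm a b₁ b₂ b₃ c₁ c₂ c₃ x y z i

end SrivastavaHB

namespace SrivastavaHB

open Filter Topology

/-! The Mellin transform acts term by term. Substituting `p = t(1-t)w` in the double integral over
`p` and `t` separates it into the Mellin transform of `K_{ν+1/2}` at `s + 1/2` and a factor
`(t(1-t))^(s+1/2)`. That factor turns the weight `t^(u-3/2) (1-t)^(v-3/2)` into the integrand of
`B(u+s, v+s)` (`cpow_scale_mul`, `hasMellin_extBeta`). The Bessel transform
(`hasMellin_besselKReal`) reduces to a Beta integral written with `cosh`, and supplies the two Gamma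
factors.

Interchanging sum and integral needs summable `L¹` norms. Up to a factor independent of the indices
these are bounded by the Beta function at the real parts of the shifted arguments, so one
convergence result (`summable_term_of_norm_le`) serves both series and the interchange. It holds
because Pochhammer symbols and Gamma values agree with factorials up to factors `q^n`, `q > 1`
arbitrary. What remains is a product of three binomial coefficients, bounded on the surface `r₁ + r₂
+ r₃ + 2√(r₁r₂r₃) = 1` (`multinomial_mul_pow_le_one`). -/

/-! ### Subexponential comparison of Pochhammer symbols and Gamma values with factorials -/

/-- By the ratio test `∑ v n / q ^ n` converges, so its terms are bounded. -/
theorem exists_le_mul_pow_of_ratio_tendsto_one {v ρ : ℕ → ℝ} (hv : ∀ n, v (n + 1) = v n * ρ n)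
    (hρ : Tendsto ρ atTop (𝓝 1)) {q : ℝ} (hq : 1 < q) :
    ∃ C, 0 < C ∧ ∀ n, |v n| ≤ C * q ^ n := by
  have hq0 : 0 < q := by linarith
  obtain ⟨r, hr1, hrq⟩ := exists_between hq
  have hs : Summable (fun n => v n / q ^ n) := by
    refine summable_of_ratio_norm_eventually_le (r := r / q) (by rwa [div_lt_one hq0]) ?_
    have := (hρ.abs.eventually_le_const (u := r) (by simpa using hr1))
    filter_upwards [this] with n hn
    rw [hv, norm_div, norm_div, norm_mul, pow_succ, norm_mul, Real.norm_of_nonneg hq0.le,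
      Real.norm_eq_abs (ρ n)]
    have : ‖v n‖ * |ρ n| / (‖q ^ n‖ * q) = |ρ n| / q * (‖v n‖ / ‖q ^ n‖) := by
      rw [div_mul_div_comm]; ring
    rw [this]
    gcongr
  obtain ⟨C, hC⟩ := hs.tendsto_atTop_zero.abs.bddAbove_range
  refine ⟨max C 1, by positivity, fun n => ?_⟩
  have h1 : |v n / q ^ n| ≤ C := hC ⟨n, rfl⟩
  have hqn : 0 < q ^ n := by positivity
  rw [abs_div, abs_of_pos hqn, div_le_iff₀ hqn] at h1
  exact h1.trans (by gcongr; exact le_max_left _ _)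

theorem poch_succ (l : ℂ) (n : ℕ) : poch l (n + 1) = poch l n * (l + n) := by
  simp [poch, ascPochhammer_succ_eval]

theorem tendsto_norm_add_nat_div (l : ℂ) :
    Tendsto (fun n : ℕ => ‖l + n‖ / (n + 1)) atTop (𝓝 1) := by
  have h0 : Tendsto (fun n : ℕ => (1 : ℝ) / ((n : ℝ) + 1)) atTop (𝓝 0) :=
    tendsto_one_div_add_atTop_nhds_zero_nat
  have h2 : Tendsto (fun n : ℕ => 1 + (l - 1) * ((1 / ((n : ℝ) + 1) : ℝ) : ℂ)) atTop (𝓝 1) := by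
    have := ((Complex.continuous_ofReal.tendsto 0).comp h0).const_mul (l - 1) |>.const_add 1
    simpa using this
  have h3 := h2.norm
  rw [norm_one] at h3
  refine h3.congr fun n => ?_
  have hn : (0 : ℝ) < n + 1 := by positivity
  have hn' : ((n : ℂ) + 1) ≠ 0 := by exact_mod_cast hn.ne'
  have : 1 + (l - 1) * ((1 / ((n : ℝ) + 1) : ℝ) : ℂ) = (l + n) / ((n + 1 : ℝ) : ℂ) := by
    push_cast
    field_simp
    ring
  rw [this, norm_div, Complex.norm_real, Real.norm_of_nonneg hn.le]

theorem exists_norm_poch_le (l : ℂ) {q : ℝ} (hq : 1 < q) :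
    ∃ C, 0 < C ∧ ∀ n, ‖poch l n‖ ≤ C * q ^ n * n.factorial := by
  obtain ⟨C, hC, h⟩ := exists_le_mul_pow_of_ratio_tendsto_one
    (v := fun n => ‖poch l n‖ / n.factorial) (fun n => by
      rw [poch_succ, norm_mul, Nat.factorial_succ]
      push_cast
      rw [div_mul_div_comm, mul_comm (n.factorial : ℝ)]) (tendsto_norm_add_nat_div l) hq
  refine ⟨C, hC, fun n => ?_⟩
  have h1 := (le_abs_self _).trans (h n)
  rwa [div_le_iff₀ (by positivity)] at h1

/-- If `l` is a non-positive integer, the quotient is eventually `n! / 0 = 0` and the ratio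
recurrence still holds. -/
theorem exists_factorial_div_norm_poch_le (l : ℂ) {q : ℝ} (hq : 1 < q) :
    ∃ C, 0 < C ∧ ∀ n : ℕ, n.factorial / ‖poch l n‖ ≤ C * q ^ n := by
  have ht := (tendsto_norm_add_nat_div l).inv₀ one_ne_zero
  rw [inv_one] at ht
  obtain ⟨C, hC, h⟩ := exists_le_mul_pow_of_ratio_tendsto_one
    (v := fun n => (n.factorial : ℝ) / ‖poch l n‖) (fun n => by
      rw [poch_succ, norm_mul, Nat.factorial_succ]
      push_cast
      rw [inv_div, div_mul_div_comm, mul_comm (n.factorial : ℝ)]) ht hq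
  exact ⟨C, hC, fun n => (le_abs_self _).trans (h n)⟩

theorem tendsto_add_nat_div {A : ℝ} (hA : 0 < A) :
    Tendsto (fun n : ℕ => (A + n) / (n + 1)) atTop (𝓝 1) := by
  refine (tendsto_norm_add_nat_div A).congr fun n => ?_
  congr 1
  rw [← Complex.ofReal_natCast, ← Complex.ofReal_add, Complex.norm_real,
    Real.norm_of_nonneg (by positivity)]

theorem Gamma_add_nat_succ {A : ℝ} (hA : 0 < A) (n : ℕ) :
    Real.Gamma (A + (n + 1 : ℕ)) = Real.Gamma (A + n) * (A + n) := by
  push_cast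
  rw [← add_assoc, Real.Gamma_add_one (by positivity), mul_comm]

/-- Each of the three Gamma values is traded for a factorial. The two numerators together cost `q ^
(i + j)`, and the denominator costs the same again. -/
theorem exists_beta_add_nat_le {A B : ℝ} (hA : 0 < A) (hB : 0 < B) {q : ℝ} (hq : 1 < q) :
    ∃ C, 0 < C ∧ ∀ i j : ℕ, ProbabilityTheory.beta (A + i) (B + j) ≤
      C * q ^ (2 * (i + j)) * (i.factorial * j.factorial / (i + j).factorial) := by
  have up : ∀ {A : ℝ}, 0 < A → ∃ C, 0 < C ∧ ∀ n : ℕ,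
      Real.Gamma (A + n) ≤ C * q ^ n * n.factorial := by
    intro A hA
    obtain ⟨C, hC, h⟩ := exists_le_mul_pow_of_ratio_tendsto_one
      (v := fun n => Real.Gamma (A + n) / n.factorial) (fun n => by
        rw [Gamma_add_nat_succ hA, Nat.factorial_succ]
        push_cast
        rw [div_mul_div_comm, mul_comm (n.factorial : ℝ)]) (tendsto_add_nat_div hA) hq
    refine ⟨C, hC, fun n => ?_⟩
    have h1 := (le_abs_self _).trans (h n)
    rwa [div_le_iff₀ (by positivity)] at h1
  have hAB : 0 < A + B := by positivity
  have ht := (tendsto_add_nat_div hAB).inv₀ one_ne_zero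
  rw [inv_one] at ht
  obtain ⟨C₃, hC₃, h₃⟩ := exists_le_mul_pow_of_ratio_tendsto_one
      (v := fun n => n.factorial / Real.Gamma (A + B + n)) (fun n => by
        rw [Gamma_add_nat_succ hAB, Nat.factorial_succ]
        push_cast
        rw [inv_div, div_mul_div_comm, mul_comm (n.factorial : ℝ)]) ht hq
  obtain ⟨C₁, hC₁, h₁⟩ := up hA
  obtain ⟨C₂, hC₂, h₂⟩ := up hB
  refine ⟨C₁ * C₂ * C₃, by positivity, fun i j => ?_⟩
  have hG : 0 < Real.Gamma (A + B + (i + j : ℕ)) := Real.Gamma_pos_of_pos (by positivity)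
  have hf : (0 : ℝ) < (i + j).factorial := by positivity
  have h3 := (le_abs_self _).trans (h₃ (i + j))
  have h3' : 1 / Real.Gamma (A + B + (i + j : ℕ)) ≤ C₃ * q ^ (i + j) / (i + j).factorial := by
    rw [le_div_iff₀ hf, one_div, inv_mul_eq_div]
    exact h3
  have e : A + i + (B + j) = A + B + (i + j : ℕ) := by push_cast; ring
  have hGB : 0 ≤ Real.Gamma (B + j) := (Real.Gamma_pos_of_pos (by positivity)).le
  rw [ProbabilityTheory.beta, e, div_eq_mul_one_div]
  have hq0 : 0 < q := by linarith
  calc _ ≤ (C₁ * q ^ i * i.factorial) * (C₂ * q ^ j * j.factorial) *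
        (C₃ * q ^ (i + j) / (i + j).factorial) := by
        gcongr
        · exact h₁ i
        · exact h₂ j
    _ = _ := by rw [two_mul, pow_add q (i + j), pow_add q i j]; ring

/-! ### Absolute convergence of the triple series -/

/-- This is a single term of the binomial expansion of `(a + (1 - a)) ^ (m + n) = 1`. -/
theorem choose_mul_pow_mul_pow_le_one {a : ℝ} (h0 : 0 ≤ a) (h1 : a ≤ 1) (m n : ℕ) :
    ((m + n).factorial / (m.factorial * n.factorial) : ℝ) * (a ^ m * (1 - a) ^ n) ≤ 1 := by
  have hc : ((m + n).factorial / (m.factorial * n.factorial) : ℝ) = (m + n).choose m := by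
    rw [← Nat.add_choose_mul_factorial_mul_factorial, Nat.choose_symm_add]
    push_cast
    field_simp
  have h := add_pow a (1 - a) (m + n)
  rw [add_sub_cancel, one_pow] at h
  rw [hc]
  refine le_trans (le_of_eq ?_) ((Finset.single_le_sum (f := fun i =>
    a ^ i * (1 - a) ^ (m + n - i) * ((m + n).choose i : ℝ)) (fun i _ => ?_)
      (Finset.mem_range.2 (by omega : m < m + n + 1))).trans_eq h.symm)
  · simp only [Nat.add_sub_cancel_left]; ring
  · have : 0 ≤ 1 - a := by linarith
    positivity

/-- On the boundary surface of the convergence domain the majorant of Srivastava's triple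
series has bounded terms. -/
theorem multinomial_mul_pow_le_one {r₁ r₂ r₃ : ℝ} (h₁ : 0 < r₁) (h₂ : 0 < r₂) (h₃ : 0 < r₃)
    (hr : r₁ + r₂ + r₃ + 2 * Real.sqrt (r₁ * r₂ * r₃) = 1) (m n k : ℕ) :
    ((n + k).factorial / (n.factorial * k.factorial) : ℝ) *
      ((k + m).factorial / (k.factorial * m.factorial)) *
      ((m + n).factorial / (m.factorial * n.factorial)) * (r₁ ^ m * r₂ ^ n * r₃ ^ k) ≤ 1 := by
  set w := Real.sqrt (r₁ * r₂ * r₃) with hw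
  have hw0 : 0 < w := Real.sqrt_pos.2 (by positivity)
  have hw2 : w ^ 2 = r₁ * r₂ * r₃ := Real.sq_sqrt (by positivity)
  -- Each binomial coefficient gets its own pair of weights summing to 1, chosen so that every `rᵢ`
  -- is the product of the two weights with numerator `rᵢ + w`.
  have key : ∀ a b : ℝ, 0 < a → 0 < b → 0 ≤ (a + w) / (a + b + 2 * w) ∧
      (a + w) / (a + b + 2 * w) ≤ 1 ∧
      1 - (a + w) / (a + b + 2 * w) = (b + w) / (a + b + 2 * w) := by
    intro a b ha hb
    have : 0 < a + b + 2 * w := by positivity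
    refine ⟨by positivity, by rw [div_le_one this]; linarith, ?_⟩
    field_simp
    ring
  obtain ⟨p₁, p₂, p₃⟩ := key r₂ r₃ h₂ h₃
  obtain ⟨s₁, s₂, s₃⟩ := key r₃ r₁ h₃ h₁
  obtain ⟨t₁, t₂, t₃⟩ := key r₁ r₂ h₁ h₂
  have k₁ := choose_mul_pow_mul_pow_le_one p₁ p₂ n k
  have k₂ := choose_mul_pow_mul_pow_le_one s₁ s₂ k m
  have k₃ := choose_mul_pow_mul_pow_le_one t₁ t₂ m n
  rw [p₃] at k₁
  rw [s₃] at k₂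
  rw [t₃] at k₃
  -- By `hr` the denominators are `1 - r₂` and `1 - r₃`, and `r₁ (1 - r₂) (1 - r₃) = r₁ (r₁ + 2w) +
  -- w² = (r₁ + w)²`.
  have e₁ : r₁ = (r₁ + w) / (r₃ + r₁ + 2 * w) * ((r₁ + w) / (r₁ + r₂ + 2 * w)) := by
    rw [div_mul_div_comm, eq_div_iff (by positivity)]
    linear_combination r₁ * (r₁ + 2 * w) * hr - hw2
  have e₂ : r₂ = (r₂ + w) / (r₂ + r₃ + 2 * w) * ((r₂ + w) / (r₁ + r₂ + 2 * w)) := by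
    rw [div_mul_div_comm, eq_div_iff (by positivity)]
    linear_combination r₂ * (r₂ + 2 * w) * hr - hw2
  have e₃ : r₃ = (r₃ + w) / (r₂ + r₃ + 2 * w) * ((r₃ + w) / (r₃ + r₁ + 2 * w)) := by
    rw [div_mul_div_comm, eq_div_iff (by positivity)]
    linear_combination r₃ * (r₃ + 2 * w) * hr - hw2
  have : r₁ ^ m * r₂ ^ n * r₃ ^ k =
      (((r₂ + w) / (r₂ + r₃ + 2 * w)) ^ n * ((r₃ + w) / (r₂ + r₃ + 2 * w)) ^ k) *
      (((r₃ + w) / (r₃ + r₁ + 2 * w)) ^ k * ((r₁ + w) / (r₃ + r₁ + 2 * w)) ^ m) *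
      (((r₁ + w) / (r₁ + r₂ + 2 * w)) ^ m * ((r₂ + w) / (r₁ + r₂ + 2 * w)) ^ n) := by
    rw [congrArg (· ^ m) e₁, congrArg (· ^ n) e₂, congrArg (· ^ k) e₃]
    simp only [mul_pow]
    ring
  rw [this]
  calc _ = _ := by ring
    _ ≤ (1 : ℝ) := mul_le_one₀ (mul_le_one₀ k₁ (by positivity) k₂) (by positivity) k₃

theorem eventually_mul_pow_lt {a r : ℝ} (h : a < r) (N : ℕ) :
    ∀ᶠ q in 𝓝[>] (1 : ℝ), a * q ^ N < r := by
  have : Tendsto (fun q : ℝ => a * q ^ N) (𝓝 1) (𝓝 a) := by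
    have : ContinuousAt (fun q : ℝ => a * q ^ N) 1 := by fun_prop
    simpa [ContinuousAt] using this
  exact (this.eventually_lt_const h).filter_mono nhdsWithin_le_nhds

theorem summable_geometric_triple {a b c : ℝ} (ha : 0 ≤ a) (hb : 0 ≤ b) (hc : 0 ≤ c)
    (ha' : a < 1) (hb' : b < 1) (hc' : c < 1) :
    Summable (fun i : ℕ × ℕ × ℕ => a ^ i.1 * (b ^ i.2.1 * c ^ i.2.2)) := by
  have h := (summable_geometric_of_lt_one hb hb').mul_of_nonneg
    (summable_geometric_of_lt_one hc hc') (fun _ => by positivity) (fun _ => by positivity)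
  exact (summable_geometric_of_lt_one ha ha').mul_of_nonneg h
    (fun _ => by positivity) (fun _ => by simp only [Pi.zero_apply]; positivity)

theorem regroup_norm_term {P Q c₁ c₂ c₃ f β X Y Z M N K : ℝ} (hM : M ≠ 0) (hN : N ≠ 0)
    (hK : K ≠ 0) : P * Q / (c₁ * c₂ * c₃) * (f / β) * (X / M) * (Y / N) * (Z / K) =
      P * Q * (M / c₁) * (N / c₂) * (K / c₃) * f / β * (X * Y * Z) /
        (M ^ 2 * N ^ 2 * K ^ 2) := by
  have e : ∀ {a : ℝ}, a ≠ 0 → a / a ^ 2 = a⁻¹ := fun h => by field_simp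
  calc _ = P * Q * c₁⁻¹ * c₂⁻¹ * c₃⁻¹ * f / β * (X * Y * Z) * (M⁻¹ * N⁻¹ * K⁻¹) := by ring
    _ = P * Q * c₁⁻¹ * c₂⁻¹ * c₃⁻¹ * f / β * (X * Y * Z) *
        (M / M ^ 2 * (N / N ^ 2) * (K / K ^ 2)) := by rw [e hM, e hN, e hK]
    _ = _ := by ring

/-- Here `S` stands for `(2m+n+k)!`: it enters through `(b₁+b₂)_{2m+n+k}` and cancels against the
denominator of the Beta bound, leaving three binomial coefficients. -/
theorem regroup_majorant {C₁ C₂ C₃ C₄ C₅ C₆ D β X Y Z R₁ R₂ R₃ S M N K u v w : ℝ}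
    {q₁ q₂ q₃ q₄ q₅ q₆ : ℝ} (hS : S ≠ 0) (h₁ : R₁ ≠ 0) (h₂ : R₂ ≠ 0) (h₃ : R₃ ≠ 0) :
    C₁ * q₁ * S * (C₂ * q₂ * u) * (C₃ * q₃) * (C₄ * q₄) * (C₅ * q₅) *
        (D * (C₆ * q₆ * (v * w / S))) / β * (X * Y * Z) / (M ^ 2 * N ^ 2 * K ^ 2) =
      C₁ * C₂ * C₃ * C₄ * C₅ * C₆ * D / β * (X / R₁ * (Y / R₂) * (Z / R₃)) *
        (u / (N * K) * (v / (K * M)) * (w / (M * N)) * (R₁ * R₂ * R₃)) *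
        (q₁ * q₂ * q₃ * q₄ * q₅ * q₆) := by
  have e₁ : X / R₁ * (Y / R₂) * (Z / R₃) = X * Y * Z / (R₁ * R₂ * R₃) := by
    rw [div_mul_div_comm, div_mul_div_comm]
  have e₂ : X * Y * Z = X * Y * Z / (R₁ * R₂ * R₃) * (R₁ * R₂ * R₃) := by
    rw [div_mul_cancel₀ _ (by simp [*])]
  have e₃ : v * w = S * (v * w / S) := by rw [mul_div_cancel₀ _ hS]
  rw [e₁]
  calc _ = C₁ * C₂ * C₃ * C₄ * C₅ * C₆ * D / β * u / (M ^ 2 * N ^ 2 * K ^ 2) *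
        (q₁ * q₂ * q₃ * q₄ * q₅ * q₆) * (X * Y * Z) * (S * (v * w / S)) := by ring
    _ = C₁ * C₂ * C₃ * C₄ * C₅ * C₆ * D / β * u / (M ^ 2 * N ^ 2 * K ^ 2) *
        (q₁ * q₂ * q₃ * q₄ * q₅ * q₆) * (X * Y * Z / (R₁ * R₂ * R₃) * (R₁ * R₂ * R₃)) *
        (v * w) := by rw [← e₂, ← e₃]
    _ = _ := by ring

theorem summable_term_of_norm_le {b₁ b₂ b₃ c₁ c₂ c₃ x y z : ℂ} {r₁ r₂ r₃ : ℝ}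
    (hr : r₁ + r₂ + r₃ + 2 * Real.sqrt (r₁ * r₂ * r₃) = 1)
    (hx : ‖x‖ < r₁) (hy : ‖y‖ < r₂) (hz : ‖z‖ < r₃) {F : ℂ → ℂ → ℂ} {A B D : ℝ}
    (hA : 0 < A) (hB : 0 < B)
    (hF : ∀ m n k : ℕ, ‖F (b₁ + m + k) (b₂ + m + n)‖ ≤
      D * ProbabilityTheory.beta (A + (m + k : ℕ)) (B + (m + n : ℕ))) :
    Summable (fun i : ℕ × ℕ × ℕ => term F b₁ b₂ b₃ c₁ c₂ c₃ x y z i.1 i.2.1 i.2.2) := by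
  have h₁ := (norm_nonneg x).trans_lt hx
  have h₂ := (norm_nonneg y).trans_lt hy
  have h₃ := (norm_nonneg z).trans_lt hz
  have hgt : ∀ᶠ q in 𝓝[>] (1 : ℝ), 1 < q := self_mem_nhdsWithin
  -- The comparisons with factorials cost `q ^ (7m + 5n + 5k)` in total; the exponent 8 covers all
  -- three indices.
  obtain ⟨q, hq1, hqx, hqy, hqz⟩ := (hgt.and
    ((eventually_mul_pow_lt hx 8).and ((eventually_mul_pow_lt hy 8).and
      (eventually_mul_pow_lt hz 8)))).exists
  have hq0 : 0 < q := by linarith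
  have hD : 0 ≤ D := by
    have h := (norm_nonneg _).trans (hF 0 0 0)
    exact nonneg_of_mul_nonneg_left h (ProbabilityTheory.beta_pos (by positivity) (by positivity))
  obtain ⟨C₁, hC₁, k₁⟩ := exists_norm_poch_le (b₁ + b₂) hq1
  obtain ⟨C₂, hC₂, k₂⟩ := exists_norm_poch_le b₃ hq1
  obtain ⟨C₃, hC₃, k₃⟩ := exists_factorial_div_norm_poch_le c₁ hq1
  obtain ⟨C₄, hC₄, k₄⟩ := exists_factorial_div_norm_poch_le c₂ hq1
  obtain ⟨C₅, hC₅, k₅⟩ := exists_factorial_div_norm_poch_le c₃ hq1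
  obtain ⟨C₆, hC₆, k₆⟩ := exists_beta_add_nat_le hA hB hq1
  have hs := (summable_geometric_triple (a := ‖x‖ * q ^ 8 / r₁) (b := ‖y‖ * q ^ 8 / r₂)
    (c := ‖z‖ * q ^ 8 / r₃) (by positivity) (by positivity) (by positivity)
    (by rwa [div_lt_one h₁]) (by rwa [div_lt_one h₂]) (by rwa [div_lt_one h₃])).mul_left
      (C₁ * C₂ * C₃ * C₄ * C₅ * C₆ * D / ‖beta b₁ b₂‖)
  refine Summable.of_norm_bounded hs ?_
  rintro ⟨m, n, k⟩
  dsimp only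
  have hT := multinomial_mul_pow_le_one h₁ h₂ h₃ hr m n k
  have hβ := (hF m n k).trans (mul_le_mul_of_nonneg_left (k₆ (m + k) (m + n)) hD)
  have e6 : m + k + (m + n) = 2 * m + n + k := by ring
  rw [e6] at hβ
  have g₃ := k₃ m
  have g₄ := k₄ n
  have g₅ := k₅ k
  rw [term]
  simp only [norm_mul, norm_div, norm_pow, Complex.norm_natCast]
  have hpow : q ^ (2 * m + n + k) * q ^ (n + k) * q ^ m * q ^ n * q ^ k *
      q ^ (2 * (2 * m + n + k)) ≤ (q ^ 8) ^ m * (q ^ 8) ^ n * (q ^ 8) ^ k := by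
    simp only [← pow_mul, ← pow_add]
    exact pow_le_pow_right₀ hq1.le (by omega)
  calc _ = ‖poch (b₁ + b₂) (2 * m + n + k)‖ * ‖poch b₃ (n + k)‖ *
        (m.factorial / ‖poch c₁ m‖) * (n.factorial / ‖poch c₂ n‖) * (k.factorial / ‖poch c₃ k‖) *
        ‖F (b₁ + m + k) (b₂ + m + n)‖ / ‖beta b₁ b₂‖ * (‖x‖ ^ m * ‖y‖ ^ n * ‖z‖ ^ k) /
        ((m.factorial : ℝ) ^ 2 * (n.factorial : ℝ) ^ 2 * (k.factorial : ℝ) ^ 2) :=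
        regroup_norm_term (by positivity) (by positivity) (by positivity)
    _ ≤ (C₁ * q ^ (2 * m + n + k) * (2 * m + n + k).factorial) *
        (C₂ * q ^ (n + k) * (n + k).factorial) *
        (C₃ * q ^ m) * (C₄ * q ^ n) * (C₅ * q ^ k) *
        (D * (C₆ * q ^ (2 * (2 * m + n + k)) *
          ((m + k).factorial * (m + n).factorial / (2 * m + n + k).factorial))) /
        ‖beta b₁ b₂‖ * (‖x‖ ^ m * ‖y‖ ^ n * ‖z‖ ^ k) /
        ((m.factorial : ℝ) ^ 2 * (n.factorial : ℝ) ^ 2 * (k.factorial : ℝ) ^ 2) := by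
        gcongr
        · exact k₁ _
        · exact k₂ _
    _ = (C₁ * C₂ * C₃ * C₄ * C₅ * C₆ * D / ‖beta b₁ b₂‖) * ((‖x‖ / r₁) ^ m * (‖y‖ / r₂) ^ n *
        (‖z‖ / r₃) ^ k) * (((n + k).factorial / (n.factorial * k.factorial) : ℝ) *
      ((k + m).factorial / (k.factorial * m.factorial)) *
      ((m + n).factorial / (m.factorial * n.factorial)) * (r₁ ^ m * r₂ ^ n * r₃ ^ k)) *
      (q ^ (2 * m + n + k) * q ^ (n + k) * q ^ m * q ^ n * q ^ k *
      q ^ (2 * (2 * m + n + k))) := by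
        rw [add_comm k m]
        simp only [div_pow]
        exact regroup_majorant (by positivity) (by positivity) (by positivity) (by positivity)
    _ ≤ (C₁ * C₂ * C₃ * C₄ * C₅ * C₆ * D / ‖beta b₁ b₂‖) * ((‖x‖ / r₁) ^ m * (‖y‖ / r₂) ^ n *
        (‖z‖ / r₃) ^ k) * 1 * ((q ^ 8) ^ m * (q ^ 8) ^ n * (q ^ 8) ^ k) := by
        gcongr
    _ = _ := by
        rw [mul_div_right_comm, mul_div_right_comm ‖y‖, mul_div_right_comm ‖z‖]
        simp only [mul_pow]
        ring

/-! ### The Beta integral in hyperbolic form -/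

theorem integrableOn_beta_Ioo {u v : ℂ} (hu : 0 < u.re) (hv : 0 < v.re) :
    IntegrableOn (fun t : ℝ => (t : ℂ) ^ (u - 1) * (1 - (t : ℂ)) ^ (v - 1)) (Ioo 0 1) := by
  have h := Complex.betaIntegral_convergent hu hv
  rw [intervalIntegrable_iff_integrableOn_Ioo_of_le zero_le_one] at h
  exact h

theorem beta_eq_integral_Ioo {u v : ℂ} (hu : 0 < u.re) (hv : 0 < v.re) :
    beta u v = ∫ t in Ioo (0 : ℝ) 1, (t : ℂ) ^ (u - 1) * (1 - (t : ℂ)) ^ (v - 1) := by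
  rw [beta_eq_betaIntegral hu hv, Complex.betaIntegral,
    intervalIntegral.integral_of_le zero_le_one, integral_Ioc_eq_integral_Ioo]

theorem sigmoid_two_mul (u : ℝ) : Real.sigmoid (2 * u) = Real.exp u * (2 * Real.cosh u)⁻¹ := by
  have hc := Real.cosh_pos u
  have h1 : 0 < 1 + Real.exp (-(2 * u)) := by positivity
  rw [Real.sigmoid_def, inv_eq_iff_eq_inv, mul_inv, inv_inv, Real.cosh_eq, ← Real.exp_neg]
  have h2 : -(2 * u) = -u + -u := by ring
  have h3 : Real.exp (-u) * Real.exp u = 1 := by rw [← Real.exp_add]; simp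
  rw [h2, Real.exp_add]
  linear_combination -h3

theorem one_sub_sigmoid_two_mul (u : ℝ) :
    1 - Real.sigmoid (2 * u) = Real.exp (-u) * (2 * Real.cosh u)⁻¹ := by
  rw [← Real.sigmoid_neg, ← mul_neg, sigmoid_two_mul, Real.cosh_neg]

theorem ofReal_exp_cpow (u : ℝ) (a : ℂ) : ((Real.exp u : ℝ) : ℂ) ^ a = Complex.exp (u * a) := by
  rw [Complex.cpow_def_of_ne_zero (by exact_mod_cast (Real.exp_pos u).ne'),
    ← Complex.ofReal_log (Real.exp_pos u).le, Real.log_exp]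

/-- Change of variables `t = sigmoid (2u)` in the Beta integrand: the Jacobian `2t(1-t)` raises both
exponents by one, and `t`, `1 - t` equal `e^(±u) / (2 cosh u)`. -/
theorem sigmoid_cpow_mul (u : ℝ) (a b : ℂ) :
    |Real.sigmoid (2 * u) * (1 - Real.sigmoid (2 * u)) * 2| •
      ((Real.sigmoid (2 * u) : ℂ) ^ (a - 1) * (1 - (Real.sigmoid (2 * u) : ℂ)) ^ (b - 1)) =
    2 * (Complex.exp ((a - b) * u) * ((2 * Real.cosh u : ℝ) : ℂ) ^ (-(a + b))) := by
  have p1 := Real.sigmoid_pos (2 * u)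
  have p2 : 0 < 1 - Real.sigmoid (2 * u) := sub_pos.2 (Real.sigmoid_lt_one _)
  have hc : 0 < 2 * Real.cosh u := by have := Real.cosh_pos u; positivity
  have e1 : (Real.sigmoid (2 * u) : ℂ) ^ (a - 1) * (Real.sigmoid (2 * u) : ℂ) =
      (Real.sigmoid (2 * u) : ℂ) ^ a := by
    rw [Complex.cpow_sub _ _ (by exact_mod_cast p1.ne'), Complex.cpow_one,
      div_mul_cancel₀ _ (by exact_mod_cast p1.ne')]
  have e2 : (1 - (Real.sigmoid (2 * u) : ℂ)) ^ (b - 1) * (1 - (Real.sigmoid (2 * u) : ℂ)) =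
      (1 - (Real.sigmoid (2 * u) : ℂ)) ^ b := by
    rw [Complex.cpow_sub _ _ (by exact_mod_cast p2.ne'), Complex.cpow_one,
      div_mul_cancel₀ _ (by exact_mod_cast p2.ne')]
  have e3 : (1 - (Real.sigmoid (2 * u) : ℂ)) = ((1 - Real.sigmoid (2 * u) : ℝ) : ℂ) := by
    push_cast; rfl
  rw [abs_of_pos (by positivity), Complex.real_smul]
  calc _ = 2 * ((Real.sigmoid (2 * u) : ℂ) ^ a * (1 - (Real.sigmoid (2 * u) : ℂ)) ^ b) := by
        rw [← e1, ← e2]; push_cast; ring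
    _ = _ := by
      rw [e3, one_sub_sigmoid_two_mul, sigmoid_two_mul, Complex.ofReal_mul, Complex.ofReal_mul,
        Complex.mul_cpow_ofReal_nonneg (Real.exp_pos _).le (inv_pos.2 hc).le,
        Complex.mul_cpow_ofReal_nonneg (Real.exp_pos _).le (inv_pos.2 hc).le,
        ofReal_exp_cpow, ofReal_exp_cpow, Complex.ofReal_inv, Complex.cpow_neg,
        Complex.inv_cpow _ _ (by rw [Complex.arg_ofReal_of_nonneg hc.le]; exact Real.pi_pos.ne),
        Complex.inv_cpow _ _ (by rw [Complex.arg_ofReal_of_nonneg hc.le]; exact Real.pi_pos.ne),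
        Complex.cpow_add _ _ (by exact_mod_cast hc.ne'), mul_inv, sub_mul, sub_eq_add_neg,
        Complex.exp_add, Complex.ofReal_neg]
      ring_nf

theorem image_sigmoid_two_mul :
    (fun u : ℝ => Real.sigmoid (2 * u)) '' univ = Ioo 0 1 := by
  rw [image_univ, ← Real.range_sigmoid]
  exact (mul_left_surjective₀ (two_ne_zero (α := ℝ))).range_comp Real.sigmoid

theorem hasDerivWithinAt_sigmoid_two_mul (u : ℝ) :
    HasDerivWithinAt (fun u : ℝ => Real.sigmoid (2 * u))
      (Real.sigmoid (2 * u) * (1 - Real.sigmoid (2 * u)) * 2) univ u := by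
  have h := (Real.hasDerivAt_sigmoid (2 * u)).comp u ((hasDerivAt_id u).const_mul 2)
  rw [mul_one] at h
  exact h.hasDerivWithinAt

theorem injective_sigmoid_two_mul : Function.Injective fun u : ℝ => Real.sigmoid (2 * u) :=
  Real.sigmoid_injective.comp (mul_right_injective₀ two_ne_zero)

theorem integrable_exp_mul_cosh_cpow {a b : ℂ} (ha : 0 < a.re) (hb : 0 < b.re) :
    Integrable (fun u : ℝ => Complex.exp ((a - b) * u) *
      ((2 * Real.cosh u : ℝ) : ℂ) ^ (-(a + b))) := by
  have h := integrableOn_beta_Ioo ha hb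
  rw [← image_sigmoid_two_mul, integrableOn_image_iff_integrableOn_abs_deriv_smul MeasurableSet.univ
    (fun u _ => hasDerivWithinAt_sigmoid_two_mul u) injective_sigmoid_two_mul.injOn,
    integrableOn_univ] at h
  simp_rw [sigmoid_cpow_mul] at h
  simpa using h.const_mul (2⁻¹ : ℂ)

theorem integral_exp_mul_cosh_cpow {a b : ℂ} (ha : 0 < a.re) (hb : 0 < b.re) :
    ∫ u : ℝ, Complex.exp ((a - b) * u) * ((2 * Real.cosh u : ℝ) : ℂ) ^ (-(a + b)) =
      beta a b / 2 := by
  rw [beta_eq_integral_Ioo ha hb, ← image_sigmoid_two_mul,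
    integral_image_eq_integral_abs_deriv_smul MeasurableSet.univ
    (fun u _ => hasDerivWithinAt_sigmoid_two_mul u) injective_sigmoid_two_mul.injOn]
  simp_rw [sigmoid_cpow_mul]
  rw [integral_const_mul, Measure.restrict_univ]
  ring

theorem integral_Ioi_add_comp_neg {f : ℝ → ℂ} (hf : Integrable f) :
    ∫ u in Ioi (0 : ℝ), (f u + f (-u)) = ∫ u, f u := by
  rw [integral_add hf.integrableOn hf.comp_neg.integrableOn, integral_comp_neg_Ioi, neg_zero,
    ← integral_add_compl measurableSet_Ioi hf, compl_Ioi]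

theorem two_mul_cosh_mul_cpow (a b : ℂ) (u : ℝ) :
    Complex.exp ((a - b) * u) * ((2 * Real.cosh u : ℝ) : ℂ) ^ (-(a + b)) +
      Complex.exp ((a - b) * (-u : ℝ)) * ((2 * Real.cosh (-u) : ℝ) : ℂ) ^ (-(a + b)) =
    2 ^ (1 - (a + b)) * (Complex.cosh ((a - b) * u) * (Real.cosh u : ℂ) ^ (-(a + b))) := by
  rw [Real.cosh_neg, Complex.ofReal_neg, mul_neg, ← add_mul, Complex.cosh, Complex.ofReal_mul,
    Complex.mul_cpow_ofReal_nonneg zero_le_two (Real.cosh_pos u).le, sub_eq_add_neg (1 : ℂ),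
    Complex.cpow_add _ _ two_ne_zero, Complex.cpow_one, Complex.ofReal_ofNat]
  ring

/-- Folding the integral over the line onto the half-line turns the exponential into `cosh`; `a =
(μ+α)/2` and `b = (μ-α)/2` give `a - b = α`, `a + b = μ`. -/
theorem integrableOn_cosh_mul_cosh_cpow {α μ : ℂ} (h1 : 0 < (μ - α).re) (h2 : 0 < (μ + α).re) :
    IntegrableOn (fun u : ℝ => Complex.cosh (α * u) * (Real.cosh u : ℂ) ^ (-μ)) (Ioi 0) := by
  have ha : 0 < ((μ + α) / 2).re := by simpa using h2
  have hb : 0 < ((μ - α) / 2).re := by simpa using h1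
  have h := integrable_exp_mul_cosh_cpow ha hb
  have h' := (h.add h.comp_neg).const_mul ((2 : ℂ) ^ (1 - μ))⁻¹
  refine (h'.integrableOn (s := Ioi 0)).congr (ae_of_all _ fun u => ?_)
  have := two_mul_cosh_mul_cpow ((μ + α) / 2) ((μ - α) / 2) u
  simp only [Pi.add_apply]
  rw [this]
  have e1 : (μ + α) / 2 - (μ - α) / 2 = α := by ring
  have e2 : (μ + α) / 2 + (μ - α) / 2 = μ := by ring
  rw [e1, e2, inv_mul_cancel_left₀]
  simp [Complex.cpow_eq_zero_iff]

theorem integral_cosh_mul_cosh_cpow {α μ : ℂ} (h1 : 0 < (μ - α).re) (h2 : 0 < (μ + α).re) :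
    ∫ u in Ioi (0 : ℝ), Complex.cosh (α * u) * (Real.cosh u : ℂ) ^ (-μ) =
      2 ^ (μ - 2) * beta ((μ - α) / 2) ((μ + α) / 2) := by
  have ha : 0 < ((μ + α) / 2).re := by simpa using h2
  have hb : 0 < ((μ - α) / 2).re := by simpa using h1
  have h := integral_exp_mul_cosh_cpow ha hb
  rw [← integral_Ioi_add_comp_neg (integrable_exp_mul_cosh_cpow ha hb)] at h
  simp_rw [two_mul_cosh_mul_cpow] at h
  have e1 : (μ + α) / 2 - (μ - α) / 2 = α := by ring
  have e2 : (μ + α) / 2 + (μ - α) / 2 = μ := by ring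
  rw [integral_const_mul, e1, e2] at h
  have e3 : (2 : ℂ) ^ (μ - 2) * (2 ^ (1 - μ) * 2) = 1 := by
    have e : (2 : ℂ) ^ (1 : ℂ) = 2 := Complex.cpow_one 2
    calc _ = (2 : ℂ) ^ (μ - 2) * (2 ^ (1 - μ) * 2 ^ (1 : ℂ)) := by rw [e]
      _ = 2 ^ (μ - 2 + (1 - μ + 1)) := by
        rw [← Complex.cpow_add _ _ two_ne_zero, ← Complex.cpow_add _ _ two_ne_zero]
      _ = 1 := by rw [show μ - 2 + (1 - μ + 1) = 0 by ring, Complex.cpow_zero]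
  have e4 : beta ((μ - α) / 2) ((μ + α) / 2) = beta ((μ + α) / 2) ((μ - α) / 2) := by
    rw [beta, beta, mul_comm, add_comm ((μ - α) / 2)]
  rw [e4]
  calc _ = (2 : ℂ) ^ (μ - 2) * 2 * (2 ^ (1 - μ) *
        ∫ u in Ioi (0 : ℝ), Complex.cosh (α * u) * (Real.cosh u : ℂ) ^ (-μ)) := by
        linear_combination (-∫ u in Ioi (0 : ℝ),
          Complex.cosh (α * u) * (Real.cosh u : ℂ) ^ (-μ)) * e3
    _ = _ := by rw [h]; ring

/-! ### Mellin transform and pointwise bound for the Bessel function -/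

/-- The modified Bessel function of the second kind at real order and real argument. -/
noncomputable def besselKReal (α w : ℝ) : ℝ :=
  ∫ u in Ioi (0 : ℝ), Real.exp (-w * Real.cosh u) * Real.cosh (α * u)

theorem besselK_ofReal (α w : ℝ) : besselK α w = besselKReal α w := by
  rw [besselK, besselKReal, ← integral_complex_ofReal]
  congr with u
  push_cast
  rfl

theorem besselKReal_nonneg (α w : ℝ) : 0 ≤ besselKReal α w :=
  integral_nonneg fun _ => mul_nonneg (Real.exp_pos _).le (Real.cosh_pos _).le

theorem stronglyMeasurable_besselKReal (α : ℝ) : StronglyMeasurable (besselKReal α) := by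
  unfold besselKReal
  refine StronglyMeasurable.integral_prod_right (Continuous.stronglyMeasurable ?_)
  unfold Function.uncurry
  fun_prop

/-- A non-integrable function has Bochner integral 0, whereas this integral is a nonzero multiple of
`Γ(μ) ≠ 0`. -/
theorem integrableOn_cpow_mul_exp {μ : ℂ} (hμ : 0 < μ.re) {r : ℝ} (hr : 0 < r) :
    IntegrableOn (fun w : ℝ => (w : ℂ) ^ (μ - 1) * Complex.exp (-(r * w))) (Ioi 0) := by
  refine not_imp_comm.1 integral_undef ?_
  rw [Complex.integral_cpow_mul_exp_neg_mul_Ioi hμ hr]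
  refine mul_ne_zero ?_ (Complex.Gamma_ne_zero_of_re_pos hμ)
  simp [Complex.cpow_eq_zero_iff, hr.ne']

/-- Integrating the norm over `w` first gives `Γ(Re μ) cosh(αu) (cosh u)^(-Re μ)`, integrable
exactly because `|α| < Re μ`. -/
theorem integrable_besselKernel {α : ℝ} {μ : ℂ} (hμ : |α| < μ.re) :
    Integrable (fun p : ℝ × ℝ => (p.1 : ℂ) ^ (μ - 1) *
      ((Real.exp (-p.1 * Real.cosh p.2) * Real.cosh (α * p.2) : ℝ) : ℂ))
      ((volume.restrict (Ioi 0)).prod (volume.restrict (Ioi 0))) := by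
  have hμ0 : 0 < μ.re := (abs_nonneg α).trans_lt hμ
  have hα := abs_lt.1 hμ
  have hcosh : ∀ u : ℝ, Integrable (fun w : ℝ => (w : ℂ) ^ (μ - 1) *
      ((Real.exp (-w * Real.cosh u) * Real.cosh (α * u) : ℝ) : ℂ)) (volume.restrict (Ioi 0)) := by
    intro u
    refine ((integrableOn_cpow_mul_exp hμ0 (Real.cosh_pos u)).mul_const
      (Real.cosh (α * u) : ℂ)).congr (ae_of_all _ fun w => ?_)
    push_cast
    ring_nf
  rw [integrable_prod_iff']
  · refine ⟨ae_of_all _ hcosh, ?_⟩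
    have h := (integrableOn_cosh_mul_cosh_cpow (α := α) (μ := μ.re) (by simpa using hα.2)
      (by simp; linarith)).norm.mul_const (Real.Gamma μ.re)
    refine h.congr (ae_of_all _ fun u => ?_)
    have hu := Real.cosh_pos u
    have e : ∫ w in Ioi (0 : ℝ), ‖(w : ℂ) ^ (μ - 1) *
        ((Real.exp (-w * Real.cosh u) * Real.cosh (α * u) : ℝ) : ℂ)‖ =
        ∫ w in Ioi (0 : ℝ), w ^ (μ.re - 1) * Real.exp (-(Real.cosh u * w)) * Real.cosh (α * u) := by
      refine setIntegral_congr_fun measurableSet_Ioi fun w hw => ?_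
      rw [norm_mul, Complex.norm_cpow_eq_rpow_re_of_pos hw, Complex.norm_real, Real.norm_of_nonneg
        (mul_nonneg (Real.exp_pos _).le (Real.cosh_pos _).le)]
      simp only [Complex.sub_re, Complex.one_re]
      ring_nf
    dsimp only
    rw [e, integral_mul_const, Real.integral_rpow_mul_exp_neg_mul_Ioi hμ0 hu, norm_mul,
      Complex.norm_cpow_eq_rpow_re_of_pos hu, one_div, Real.inv_rpow hu.le, ← Real.rpow_neg hu.le]
    have : Complex.cosh (α * u) = (Real.cosh (α * u) : ℝ) := by push_cast; rfl
    rw [this, Complex.norm_real, Real.norm_of_nonneg (Real.cosh_pos _).le]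
    simp only [Complex.neg_re, Complex.ofReal_re]
    ring
  · refine Measurable.aestronglyMeasurable ?_
    fun_prop

/-- After Fubini, the `Γ(μ)` from the `w`-integral cancels the denominator of `B((μ-α)/2, (μ+α)/2)`.
-/
theorem hasMellin_besselKReal {α : ℝ} {μ : ℂ} (hμ : |α| < μ.re) :
    HasMellin (fun w : ℝ => (besselKReal α w : ℂ)) μ
      (2 ^ (μ - 2) * Complex.Gamma ((μ - α) / 2) * Complex.Gamma ((μ + α) / 2)) := by
  have hμ0 : 0 < μ.re := (abs_nonneg α).trans_lt hμ
  have hα := abs_lt.1 hμ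
  have hint := integrable_besselKernel hμ
  have e : ∀ w : ℝ, (w : ℂ) ^ (μ - 1) • (besselKReal α w : ℂ) =
      ∫ u in Ioi (0 : ℝ), (w : ℂ) ^ (μ - 1) *
      ((Real.exp (-w * Real.cosh u) * Real.cosh (α * u) : ℝ) : ℂ) := by
    intro w
    rw [integral_const_mul, integral_complex_ofReal, besselKReal, smul_eq_mul]
  constructor
  · rw [MellinConvergent]
    simp_rw [e]
    exact hint.integral_prod_left
  · rw [mellin]
    simp_rw [e]
    rw [integral_integral_swap hint]
    have e' : ∀ u : ℝ, ∫ w in Ioi (0 : ℝ), (w : ℂ) ^ (μ - 1) *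
        ((Real.exp (-w * Real.cosh u) * Real.cosh (α * u) : ℝ) : ℂ) =
        (Complex.cosh (α * u) * (Real.cosh u : ℂ) ^ (-μ)) * Complex.Gamma μ := by
      intro u
      have hu := Real.cosh_pos u
      have := Complex.integral_cpow_mul_exp_neg_mul_Ioi hμ0 hu
      rw [one_div, Complex.inv_cpow _ _ (by rw [Complex.arg_ofReal_of_nonneg hu.le]; exact
        Real.pi_pos.ne), ← Complex.cpow_neg] at this
      rw [mul_assoc, ← this, ← integral_const_mul]
      congr with w
      push_cast
      ring_nf
    simp_rw [e']
    rw [integral_mul_const, integral_cosh_mul_cosh_cpow (by simpa using hα.2)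
      (by simp; linarith), beta]
    have e3 : (μ - α) / 2 + (μ + α) / 2 = μ := by ring
    rw [e3]
    field_simp [Complex.Gamma_ne_zero_of_re_pos hμ0]

theorem integrableOn_besselKernel (α : ℝ) {w : ℝ} (hw : 0 < w) :
    IntegrableOn (fun u : ℝ => Real.exp (-w * Real.cosh u) * Real.cosh (α * u)) (Ioi 0) := by
  -- Fubini gives integrability only for almost every parameter; one such `w' < w` suffices, since
  -- the kernel decreases in the parameter.
  have h := (integrable_besselKernel (α := α) (μ := (|α| + 1 : ℝ)) (by simp)).prod_right_ae
  have h := ae_restrict_of_ae_restrict_of_subset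
    (show Ioo 0 w ⊆ Ioi 0 from Ioo_subset_Ioi_self) h
  have : (ae (volume.restrict (Ioo 0 w))).NeBot := by
    rw [ae_neBot, Ne, Measure.restrict_eq_zero]
    simp [hw]
  obtain ⟨w', hi, hw0, hw'⟩ := (h.and (ae_restrict_mem measurableSet_Ioo)).exists
  have hne : (w' : ℂ) ^ (((|α| + 1 : ℝ) : ℂ) - 1) ≠ 0 := by
    simp [Complex.cpow_eq_zero_iff, hw0.ne']
  have hi' := (hi.const_mul ((w' : ℂ) ^ (((|α| + 1 : ℝ) : ℂ) - 1))⁻¹).re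
  refine hi'.mono (Continuous.aestronglyMeasurable (by fun_prop)) (ae_of_all _ fun u => ?_)
  have hu := Real.cosh_pos u
  have hu' := Real.cosh_pos (α * u)
  simp only
  rw [inv_mul_cancel_left₀ hne, RCLike.re_to_complex, Complex.ofReal_re,
    Real.norm_of_nonneg (by positivity), Real.norm_of_nonneg (by positivity)]
  gcongr

theorem besselKReal_anti (α : ℝ) {w w' : ℝ} (hw' : 0 < w') (h : w' ≤ w) :
    besselKReal α w ≤ besselKReal α w' := by
  refine setIntegral_mono (integrableOn_besselKernel α (hw'.trans_le h))
    (integrableOn_besselKernel α hw') fun u => ?_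
  have hu := Real.cosh_pos u
  have hu' := Real.cosh_pos (α * u)
  dsimp only
  gcongr

theorem integrableOn_rpow_mul_besselKReal {α μ : ℝ} (hμ : |α| < μ) :
    IntegrableOn (fun w : ℝ => w ^ (μ - 1) * besselKReal α w) (Ioi 0) := by
  have h := (hasMellin_besselKReal (α := α) (μ := μ) (by simpa using hμ)).1.norm
  refine h.congr ((ae_restrict_iff' measurableSet_Ioi).2 (ae_of_all _ fun w hw => ?_))
  simp only
  rw [norm_smul, Complex.norm_cpow_eq_rpow_re_of_pos hw, Complex.norm_real,
    Real.norm_of_nonneg (besselKReal_nonneg α w)]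
  simp

/-- By monotonicity `K(w) w^μ / μ ≤ ∫₀^w q^(μ-1) K(q) dq`, which is at most the full Mellin
integral. -/
theorem exists_besselKReal_le {α μ : ℝ} (hμ : |α| < μ) :
    ∃ M, 0 ≤ M ∧ ∀ w, 0 < w → besselKReal α w ≤ M * w ^ (-μ) := by
  have hμ0 : 0 < μ := (abs_nonneg α).trans_lt hμ
  have hi := integrableOn_rpow_mul_besselKReal hμ
  have hnn : ∀ w ∈ Ioi (0 : ℝ), 0 ≤ w ^ (μ - 1) * besselKReal α w := fun w hw =>
    mul_nonneg (Real.rpow_nonneg (le_of_lt hw) _) (besselKReal_nonneg α w)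
  refine ⟨μ * ∫ w in Ioi (0 : ℝ), w ^ (μ - 1) * besselKReal α w,
    mul_nonneg hμ0.le (setIntegral_nonneg measurableSet_Ioi hnn), fun w hw => ?_⟩
  have hint : IntegrableOn (fun q : ℝ => q ^ (μ - 1)) (Ioc 0 w) := by
    rw [← intervalIntegrable_iff_integrableOn_Ioc_of_le hw.le]
    exact intervalIntegral.intervalIntegrable_rpow' (by linarith)
  have h1 : w ^ μ / μ * besselKReal α w ≤
      ∫ w in Ioi (0 : ℝ), w ^ (μ - 1) * besselKReal α w :=
    calc _ = ∫ q in Ioc 0 w, q ^ (μ - 1) * besselKReal α w := by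
          rw [integral_mul_const, ← intervalIntegral.integral_of_le hw.le,
            integral_rpow (Or.inl (by linarith)), sub_add_cancel, Real.zero_rpow hμ0.ne', sub_zero]
      _ ≤ ∫ q in Ioc 0 w, q ^ (μ - 1) * besselKReal α q := by
          refine setIntegral_mono_on (hint.mul_const _) (hi.mono_set Ioc_subset_Ioi_self)
            measurableSet_Ioc fun q hq => ?_
          exact mul_le_mul_of_nonneg_left (besselKReal_anti α hq.1 hq.2)
            (Real.rpow_nonneg hq.1.le _)
      _ ≤ _ := setIntegral_mono_set hi ((ae_restrict_iff' measurableSet_Ioi).2 (ae_of_all _ hnn))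
          (ae_of_all _ Ioc_subset_Ioi_self)
  have hwμ : 0 < w ^ μ := Real.rpow_pos_of_pos hw μ
  rw [Real.rpow_neg hw.le]
  calc besselKReal α w = μ * (w ^ μ / μ * besselKReal α w) * (w ^ μ)⁻¹ := by field_simp
    _ ≤ _ := by gcongr

/-! ### Mellin transform of the extended Beta function -/

theorem integral_norm_beta {u v : ℂ} (hu : 0 < u.re) (hv : 0 < v.re) :
    ∫ t in Ioo (0 : ℝ) 1, ‖(t : ℂ) ^ (u - 1) * (1 - (t : ℂ)) ^ (v - 1)‖ =
      ProbabilityTheory.beta u.re v.re := by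
  have h := beta_eq_integral_Ioo (u := u.re) (v := v.re) (by simpa) (by simpa)
  have e : beta u.re v.re = (ProbabilityTheory.beta u.re v.re : ℂ) := by
    rw [beta, ProbabilityTheory.beta, ← Complex.ofReal_add]
    simp only [Complex.Gamma_ofReal]
    push_cast
    rfl
  rw [e] at h
  have : ∫ t in Ioo (0 : ℝ) 1, (t : ℂ) ^ ((u.re : ℂ) - 1) * (1 - (t : ℂ)) ^ ((v.re : ℂ) - 1) =
      ∫ t in Ioo (0 : ℝ) 1, ((‖(t : ℂ) ^ (u - 1) * (1 - (t : ℂ)) ^ (v - 1)‖ : ℝ) : ℂ) := by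
    refine setIntegral_congr_fun measurableSet_Ioo fun t ht => ?_
    have ht1 : 0 < 1 - t := sub_pos.2 ht.2
    have e1 : (1 - (t : ℂ)) = ((1 - t : ℝ) : ℂ) := by push_cast; rfl
    have e2 : ∀ w : ℂ, (w.re : ℂ) - 1 = ((w - 1).re : ℂ) := fun w => by simp
    simp only [e1, e2]
    rw [norm_mul, Complex.norm_cpow_eq_rpow_re_of_pos ht.1,
      Complex.norm_cpow_eq_rpow_re_of_pos ht1, ← Complex.ofReal_cpow ht.1.le,
      ← Complex.ofReal_cpow ht1.le, ← Complex.ofReal_mul]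
  rw [this, integral_complex_ofReal] at h
  exact_mod_cast h.symm

/-- The integrand of the Mellin transform of the extended Beta function, up to a constant. -/
noncomputable def extBetaMellinKernel (α : ℝ) (s u v : ℂ) (p t : ℝ) : ℂ :=
  (p : ℂ) ^ (s + 1 / 2 - 1) • (besselKReal α ((t * (1 - t))⁻¹ * p) : ℂ) *
    ((t : ℂ) ^ (u - 3 / 2) * (1 - (t : ℂ)) ^ (v - 3 / 2))

/-- Source of the shift by `s`: rescaling `p` by `t(1-t)` contributes the power `s + 1/2`, and `u -
3/2 + (s + 1/2) = u + s - 1`. -/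
theorem cpow_scale_mul {s u v : ℂ} {t : ℝ} (ht : t ∈ Ioo (0 : ℝ) 1) :
    (((t * (1 - t))⁻¹ : ℝ) : ℂ) ^ (-(s + 1 / 2)) *
      ((t : ℂ) ^ (u - 3 / 2) * (1 - (t : ℂ)) ^ (v - 3 / 2)) =
    (t : ℂ) ^ (u + s - 1) * (1 - (t : ℂ)) ^ (v + s - 1) := by
  have h0 := ht.1
  have h1 : 0 < 1 - t := sub_pos.2 ht.2
  have h01 := mul_pos h0 h1
  have e : (1 - (t : ℂ)) = ((1 - t : ℝ) : ℂ) := by push_cast; rfl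
  rw [Complex.ofReal_inv, Complex.inv_cpow _ _ (by
      rw [Complex.arg_ofReal_of_nonneg h01.le]; exact Real.pi_pos.ne), Complex.cpow_neg, inv_inv,
    Complex.ofReal_mul, Complex.mul_cpow_ofReal_nonneg h0.le h1.le, e, mul_mul_mul_comm,
    ← Complex.cpow_add _ _ (by exact_mod_cast h0.ne'),
    ← Complex.cpow_add _ _ (by exact_mod_cast h1.ne')]
  congr 2 <;> ring

theorem hasMellin_extBetaMellinKernel {α : ℝ} {s : ℂ} (hα : |α| < (s + 1 / 2).re) (u v : ℂ)
    {t : ℝ} (ht : t ∈ Ioo (0 : ℝ) 1) :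
    IntegrableOn (fun p => extBetaMellinKernel α s u v p t) (Ioi 0) ∧
    ∫ p in Ioi (0 : ℝ), extBetaMellinKernel α s u v p t =
      2 ^ (s + 1 / 2 - 2) * Complex.Gamma ((s + 1 / 2 - α) / 2) *
        Complex.Gamma ((s + 1 / 2 + α) / 2) *
        ((t : ℂ) ^ (u + s - 1) * (1 - (t : ℂ)) ^ (v + s - 1)) := by
  have ha : 0 < (t * (1 - t))⁻¹ := inv_pos.2 (mul_pos ht.1 (sub_pos.2 ht.2))
  have h := hasMellin_besselKReal hα
  constructor
  · exact ((MellinConvergent.comp_mul_left ha).2 h.1).mul_const _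
  · have e := mellin_comp_mul_left (fun w : ℝ => (besselKReal α w : ℂ)) (s + 1 / 2) ha
    rw [mellin] at e
    simp only [extBetaMellinKernel]
    rw [integral_mul_const, e, h.2, smul_eq_mul, mul_right_comm, cpow_scale_mul ht, mul_comm]

theorem integral_norm_extBetaMellinKernel (α : ℝ) (s u v : ℂ) {t : ℝ} (ht : t ∈ Ioo (0 : ℝ) 1) :
    ∫ p in Ioi (0 : ℝ), ‖extBetaMellinKernel α s u v p t‖ =
      (∫ w in Ioi (0 : ℝ), ‖(w : ℂ) ^ (s + 1 / 2 - 1) * (besselKReal α w : ℂ)‖) *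
        ‖(t : ℂ) ^ (u + s - 1) * (1 - (t : ℂ)) ^ (v + s - 1)‖ := by
  have ha : 0 < (t * (1 - t))⁻¹ := inv_pos.2 (mul_pos ht.1 (sub_pos.2 ht.2))
  have h := integral_comp_mul_left_Ioi
    (fun w : ℝ => ‖(w : ℂ) ^ (s + 1 / 2 - 1) * (besselKReal α w : ℂ)‖) 0 ha
  rw [mul_zero, smul_eq_mul, inv_mul_eq_div, eq_div_iff ha.ne'] at h
  rw [← h, ← cpow_scale_mul ht, ← integral_mul_const, ← integral_mul_const]
  refine setIntegral_congr_fun measurableSet_Ioi fun p hp => ?_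
  have hp' : (0 : ℝ) < p := hp
  simp only [extBetaMellinKernel, smul_eq_mul, norm_mul]
  rw [Complex.norm_cpow_eq_rpow_re_of_pos ha, Complex.norm_cpow_eq_rpow_re_of_pos hp',
    Complex.norm_cpow_eq_rpow_re_of_pos (mul_pos ha hp'), Real.mul_rpow ha.le hp'.le]
  have e : (t * (1 - t))⁻¹ ^ (s + 1 / 2 - 1).re * (t * (1 - t))⁻¹ *
      (t * (1 - t))⁻¹ ^ (-(s + 1 / 2)).re = 1 := by
    nth_rw 2 [← Real.rpow_one (t * (1 - t))⁻¹]
    rw [← Real.rpow_add ha, ← Real.rpow_add ha]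
    have : (s + 1 / 2 - 1).re + 1 + (-(s + 1 / 2)).re = 0 := by
      simp only [Complex.sub_re, Complex.neg_re, Complex.one_re]; ring
    rw [this, Real.rpow_zero]
  linear_combination (-(p ^ (s + 1 / 2 - 1).re * ‖(besselKReal α ((t * (1 - t))⁻¹ * p) : ℂ)‖ *
    (‖(t : ℂ) ^ (u - 3 / 2)‖ * ‖(1 - (t : ℂ)) ^ (v - 3 / 2)‖))) * e

theorem integrable_extBetaMellinKernel {α : ℝ} {s u v : ℂ} (hα : |α| < (s + 1 / 2).re)
    (hu : 0 < (u + s).re) (hv : 0 < (v + s).re) :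
    Integrable (Function.uncurry (extBetaMellinKernel α s u v))
      ((volume.restrict (Ioi 0)).prod (volume.restrict (Ioo 0 1))) := by
  rw [integrable_prod_iff']
  · constructor
    · exact (ae_restrict_iff' measurableSet_Ioo).2 (ae_of_all _ fun t ht =>
        (hasMellin_extBetaMellinKernel hα u v ht).1)
    · have h := (integrableOn_beta_Ioo hu hv).norm.const_mul
        (∫ w in Ioi (0 : ℝ), ‖(w : ℂ) ^ (s + 1 / 2 - 1) * (besselKReal α w : ℂ)‖)
      refine h.congr ((ae_restrict_iff' measurableSet_Ioo).2 (ae_of_all _ fun t ht => ?_))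
      exact (integral_norm_extBetaMellinKernel α s u v ht).symm
  · refine Measurable.aestronglyMeasurable ?_
    have := (stronglyMeasurable_besselKReal α).measurable
    unfold extBetaMellinKernel Function.uncurry
    fun_prop

theorem extBeta_eq {p : ℝ} (hp : 0 < p) (ν : ℝ) (u v : ℂ) :
    extBeta p ν u v = ((Real.sqrt (2 / Real.pi) : ℝ) : ℂ) * ((p : ℂ) ^ (1 / 2 : ℂ) *
      ∫ t in Ioo (0 : ℝ) 1, (besselKReal (ν + 1 / 2) ((t * (1 - t))⁻¹ * p) : ℂ) *
        ((t : ℂ) ^ (u - 3 / 2) * (1 - (t : ℂ)) ^ (v - 3 / 2))) := by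
  have h : (2 * p / (Real.pi : ℂ)) ^ (1 / 2 : ℂ) =
      ((Real.sqrt (2 / Real.pi) : ℝ) : ℂ) * (p : ℂ) ^ (1 / 2 : ℂ) := by
    rw [Real.sqrt_eq_rpow, Complex.ofReal_cpow (by positivity)]
    push_cast
    rw [mul_div_right_comm]
    have := Complex.mul_cpow_ofReal_nonneg (a := 2 / Real.pi) (b := p) (by positivity) hp.le
      (1 / 2)
    push_cast at this
    exact this
  rw [extBeta, h, mul_assoc, intervalIntegral.integral_of_le zero_le_one,
    integral_Ioc_eq_integral_Ioo]
  congr 3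
  ext t
  have e1 : (p : ℂ) / ((t : ℂ) * (1 - (t : ℂ))) = (((t * (1 - t))⁻¹ * p : ℝ) : ℂ) := by
    push_cast
    rw [inv_mul_eq_div]
  have e2 : (ν : ℂ) + 1 / 2 = ((ν + 1 / 2 : ℝ) : ℂ) := by push_cast; rfl
  rw [e1, e2, besselK_ofReal]
  ring

theorem cpow_smul_extBeta {p : ℝ} (hp : 0 < p) (ν : ℝ) (s u v : ℂ) :
    (p : ℂ) ^ (s - 1) • extBeta p ν u v = ((Real.sqrt (2 / Real.pi) : ℝ) : ℂ) *
      ∫ t in Ioo (0 : ℝ) 1, extBetaMellinKernel (ν + 1 / 2) s u v p t := by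
  simp only [extBetaMellinKernel, smul_eq_mul, mul_assoc]
  rw [extBeta_eq hp, integral_const_mul, mul_left_comm, ← mul_assoc ((p : ℂ) ^ _),
    ← Complex.cpow_add _ _ (by exact_mod_cast hp.ne'),
    sub_add_eq_add_sub]

theorem const_mellin_extBeta (ν : ℝ) (s : ℂ) :
    ((Real.sqrt (2 / Real.pi) : ℝ) : ℂ) * (2 ^ (s + 1 / 2 - 2) *
      Complex.Gamma ((s + 1 / 2 - (ν + 1 / 2 : ℝ)) / 2) *
      Complex.Gamma ((s + 1 / 2 + (ν + 1 / 2 : ℝ)) / 2)) =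
    (2 : ℂ) ^ (s - 1) / (Real.sqrt Real.pi : ℂ) *
        Complex.Gamma ((s - ν) / 2) * Complex.Gamma ((s + ν + 1) / 2) := by
  have e1 : (s + 1 / 2 - (ν + 1 / 2 : ℝ)) / 2 = (s - ν) / 2 := by push_cast; ring
  have e2 : (s + 1 / 2 + (ν + 1 / 2 : ℝ)) / 2 = (s + ν + 1) / 2 := by push_cast; ring
  have e3 : ((Real.sqrt 2 : ℝ) : ℂ) * 2 ^ (s + 1 / 2 - 2) = 2 ^ (s - 1) := by
    rw [Real.sqrt_eq_rpow, Complex.ofReal_cpow zero_le_two]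
    push_cast
    rw [← Complex.cpow_add _ _ two_ne_zero]
    ring_nf
  rw [e1, e2, Real.sqrt_div zero_le_two, ← e3]
  push_cast
  ring

theorem hasMellin_extBeta {ν : ℝ} {s u v : ℂ} (hν : 0 < ν) (hs : ν < s.re)
    (hu : 0 < (u + s).re) (hv : 0 < (v + s).re) :
    HasMellin (fun p : ℝ => extBeta p ν u v) s
      ((2 : ℂ) ^ (s - 1) / (Real.sqrt Real.pi : ℂ) *
        Complex.Gamma ((s - ν) / 2) * Complex.Gamma ((s + ν + 1) / 2) * beta (u + s) (v + s)) := by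
  have hα : |ν + 1 / 2| < (s + 1 / 2).re := by
    rw [abs_of_pos (by positivity)]
    simpa using hs
  have hi := integrable_extBetaMellinKernel hα hu hv
  constructor
  · refine IntegrableOn.congr_fun (hi.integral_prod_left.const_mul _)
      (fun p hp => (cpow_smul_extBeta hp ν s u v).symm) measurableSet_Ioi
  · rw [mellin, setIntegral_congr_fun measurableSet_Ioi
      (fun p hp => cpow_smul_extBeta hp ν s u v), integral_const_mul, integral_integral_swap hi,
      setIntegral_congr_fun measurableSet_Ioo
      (fun t ht => (hasMellin_extBetaMellinKernel hα u v ht).2), integral_const_mul,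
      ← beta_eq_integral_Ioo hu hv, ← mul_assoc, const_mellin_extBeta]

/-- The constant is uniform in `u` and `v`, as summing over the indices of the series requires. -/
theorem exists_integral_norm_extBeta_le {ν : ℝ} {s : ℂ} (hν : 0 < ν) (hs : ν < s.re) :
    ∃ N, 0 ≤ N ∧ ∀ u v : ℂ, 0 < (u + s).re → 0 < (v + s).re →
      ∫ p in Ioi (0 : ℝ), ‖(p : ℂ) ^ (s - 1) • extBeta p ν u v‖ ≤
        N * ProbabilityTheory.beta (u + s).re (v + s).re := by
  have hα : |ν + 1 / 2| < (s + 1 / 2).re := by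
    rw [abs_of_pos (by positivity)]
    simpa using hs
  refine ⟨Real.sqrt (2 / Real.pi) * ∫ w in Ioi (0 : ℝ), ‖(w : ℂ) ^ (s + 1 / 2 - 1) *
    (besselKReal (ν + 1 / 2) w : ℂ)‖, by positivity, fun u v hu hv => ?_⟩
  have hi := integrable_extBetaMellinKernel hα hu hv
  have e : ∀ p ∈ Ioi (0 : ℝ), ‖(p : ℂ) ^ (s - 1) • extBeta p ν u v‖ ≤ Real.sqrt (2 / Real.pi) *
      ∫ t in Ioo (0 : ℝ) 1, ‖extBetaMellinKernel (ν + 1 / 2) s u v p t‖ := by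
    intro p hp
    rw [cpow_smul_extBeta hp, norm_mul, Complex.norm_real,
      Real.norm_of_nonneg (Real.sqrt_nonneg _)]
    gcongr
    exact norm_integral_le_integral_norm _
  have hin := hi.norm
  calc _ ≤ ∫ p in Ioi (0 : ℝ), Real.sqrt (2 / Real.pi) *
      ∫ t in Ioo (0 : ℝ) 1, ‖extBetaMellinKernel (ν + 1 / 2) s u v p t‖ :=
        setIntegral_mono_on (hasMellin_extBeta hν hs hu hv).1.norm
          (hin.integral_prod_left.const_mul _) measurableSet_Ioi e
    _ = _ := by
      rw [integral_const_mul, integral_integral_swap hin,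
        setIntegral_congr_fun measurableSet_Ioo
        (fun t ht => integral_norm_extBetaMellinKernel (ν + 1 / 2) s u v ht), integral_const_mul,
        integral_norm_beta hu hv, mul_assoc]

/-- Bounding `K(w)` by `M w^(-(Re s + 1/2))` makes the Beta majorant of the shifted series appear
here too. -/
theorem exists_norm_extBeta_le {ν : ℝ} {s : ℂ} (hν : 0 < ν) (hs : ν < s.re) {p : ℝ}
    (hp : 0 < p) :
    ∃ D, ∀ u v : ℂ, 0 < (u + s).re → 0 < (v + s).re →
      ‖extBeta p ν u v‖ ≤ D * ProbabilityTheory.beta (u + s).re (v + s).re := by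
  have hα : |ν + 1 / 2| < s.re + 1 / 2 := by
    rw [abs_of_pos (by positivity)]
    simpa using hs
  obtain ⟨M, hM, h⟩ := exists_besselKReal_le hα
  refine ⟨Real.sqrt (2 / Real.pi) * (p ^ (1 / 2 : ℝ) * (M * p ^ (-(s.re + 1 / 2)))),
    fun u v hu hv => ?_⟩
  have h2 : ‖(p : ℂ) ^ (1 / 2 : ℂ)‖ = p ^ (1 / 2 : ℝ) := by
    rw [Complex.norm_cpow_eq_rpow_re_of_pos hp]
    norm_num
  rw [extBeta_eq hp, norm_mul, norm_mul, Complex.norm_real,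
    Real.norm_of_nonneg (Real.sqrt_nonneg _), h2, mul_assoc, mul_assoc]
  gcongr
  rw [← integral_norm_beta hu hv, ← integral_const_mul]
  refine norm_integral_le_of_norm_le ((integrableOn_beta_Ioo hu hv).norm.const_mul _)
    ((ae_restrict_iff' measurableSet_Ioo).2 (ae_of_all _ fun t ht => ?_))
  have ha : 0 < (t * (1 - t))⁻¹ := inv_pos.2 (mul_pos ht.1 (sub_pos.2 ht.2))
  rw [← cpow_scale_mul ht, norm_mul, norm_mul (_ ^ (-(s + 1 / 2))), ← mul_assoc,
    Complex.norm_real, Real.norm_of_nonneg (besselKReal_nonneg _ _),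
    Complex.norm_cpow_eq_rpow_re_of_pos ha]
  gcongr
  refine (h _ (mul_pos ha hp)).trans_eq ?_
  rw [Real.mul_rpow ha.le hp.le]
  have : (-(s + 1 / 2)).re = -(s.re + 1 / 2) := by simp [add_comm]
  rw [this]
  ring

/-! ### Termwise integration and the main theorem -/

theorem integrable_tsum_of_summable_integral_norm {X ι : Type*} [MeasurableSpace X] [Countable ι]
    {μ : Measure X} {F : ι → X → ℂ} (hF : ∀ i, Integrable (F i) μ)
    (hsum : Summable fun i => ∫ a, ‖F i a‖ ∂μ) (hpt : ∀ᵐ a ∂μ, Summable fun i => F i a) :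
    Integrable (fun a => ∑' i, F i a) μ := by
  constructor
  · refine aestronglyMeasurable_of_tendsto_ae (atTop : Filter (Finset ι))
      (f := fun S a => ∑ i ∈ S, F i a) (fun S => ?_) (hpt.mono fun a ha => ha.hasSum)
    exact Finset.aestronglyMeasurable_fun_sum S fun i _ => (hF i).1
  · have h : ∫⁻ a, ‖∑' i, F i a‖ₑ ∂μ ≤ ∑' i, ∫⁻ a, ‖F i a‖ₑ ∂μ := by
      rw [← lintegral_tsum fun i => (hF i).1.enorm]
      exact lintegral_mono_ae (hpt.mono fun a _ => enorm_tsum_le_tsum_enorm)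
    refine h.trans_lt ?_
    have e : ∀ i, ∫⁻ a, ‖F i a‖ₑ ∂μ = ENNReal.ofReal (∫ a, ‖F i a‖ ∂μ) := fun i =>
      (ofReal_integral_norm_eq_lintegral_enorm (hF i)).symm
    simp_rw [e]
    rw [← ENNReal.ofReal_tsum_of_nonneg (fun i => integral_nonneg fun _ => norm_nonneg _) hsum]
    exact ENNReal.ofReal_lt_top

theorem term_eq_mul (F : ℂ → ℂ → ℂ) (b₁ b₂ b₃ c₁ c₂ c₃ x y z : ℂ) (m n k : ℕ) :
    term F b₁ b₂ b₃ c₁ c₂ c₃ x y z m n k =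
      term (fun _ _ => 1) b₁ b₂ b₃ c₁ c₂ c₃ x y z m n k * F (b₁ + m + k) (b₂ + m + n) := by
  simp only [term]
  ring

end SrivastavaHB

theorem theorem2 (b₁ b₂ b₃ c₁ c₂ c₃ x y z s : ℂ) (ν r₁ r₂ r₃ : ℝ)
    (hb₁ : ∀ j : ℕ, b₁ ≠ -(j : ℂ)) (hb₂ : ∀ j : ℕ, b₂ ≠ -(j : ℂ))
    (hb₁₂ : ∀ j : ℕ, b₁ + b₂ ≠ -(j : ℂ))
    (hc₁ : ∀ j : ℕ, c₁ ≠ -(j : ℂ)) (hc₂ : ∀ j : ℕ, c₂ ≠ -(j : ℂ))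
    (hc₃ : ∀ j : ℕ, c₃ ≠ -(j : ℂ))
    (hr : r₁ + r₂ + r₃ + 2 * Real.sqrt (r₁ * r₂ * r₃) = 1)
    (hx : ‖x‖ < r₁) (hy : ‖y‖ < r₂) (hz : ‖z‖ < r₃)
    (hν : 0 < ν) (hs : ν < s.re)
    (hbs₁ : 0 < (b₁ + s).re) (hbs₂ : 0 < (b₂ + s).re) :
    (∀ p : ℝ, 0 < p →
      Summable (SrivastavaHB.extHBTerm (p : ℂ) ν b₁ b₂ b₃ c₁ c₂ c₃ x y z)) ∧
    Summable (SrivastavaHB.shiftHBTerm s b₁ b₂ b₃ c₁ c₂ c₃ x y z) ∧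
    HasMellin (fun p : ℝ => SrivastavaHB.extHB (p : ℂ) ν b₁ b₂ b₃ c₁ c₂ c₃ x y z) s
      ((2 : ℂ) ^ (s - 1) / (Real.sqrt Real.pi : ℂ) *
        Complex.Gamma ((s - ν) / 2) * Complex.Gamma ((s + ν + 1) / 2) *
        SrivastavaHB.shiftHB s b₁ b₂ b₃ c₁ c₂ c₃ x y z) := by
  have er₁ : ∀ m k : ℕ, (b₁ + m + k + s).re = (b₁ + s).re + (m + k : ℕ) := by
    intro m k; simp; ring
  have er₂ : ∀ m n : ℕ, (b₂ + m + n + s).re = (b₂ + s).re + (m + n : ℕ) := by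
    intro m n; simp; ring
  have hp₁ : ∀ m k : ℕ, 0 < (b₁ + m + k + s).re := fun m k => by rw [er₁]; positivity
  have hp₂ : ∀ m n : ℕ, 0 < (b₂ + m + n + s).re := fun m n => by rw [er₂]; positivity
  have hsummable : ∀ (F : ℂ → ℂ → ℂ) (D : ℝ), (∀ u v : ℂ, 0 < (u + s).re → 0 < (v + s).re →
      ‖F u v‖ ≤ D * ProbabilityTheory.beta (u + s).re (v + s).re) →
      Summable (fun i : ℕ × ℕ × ℕ =>
        SrivastavaHB.term F b₁ b₂ b₃ c₁ c₂ c₃ x y z i.1 i.2.1 i.2.2) := by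
    intro F D hF
    refine SrivastavaHB.summable_term_of_norm_le hr hx hy hz hbs₁ hbs₂ (D := D) fun m n k => ?_
    rw [← er₁, ← er₂]
    exact hF _ _ (hp₁ m k) (hp₂ m n)
  have hext : ∀ p : ℝ, 0 < p →
      Summable (SrivastavaHB.extHBTerm (p : ℂ) ν b₁ b₂ b₃ c₁ c₂ c₃ x y z) := by
    intro p hp
    obtain ⟨D, hD⟩ := SrivastavaHB.exists_norm_extBeta_le hν hs hp
    exact hsummable _ D hD
  have hshift : Summable (SrivastavaHB.shiftHBTerm s b₁ b₂ b₃ c₁ c₂ c₃ x y z) := by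
    refine hsummable _ 1 fun u v hu hv => ?_
    rw [SrivastavaHB.beta_eq_integral_Ioo hu hv, one_mul, ← SrivastavaHB.integral_norm_beta hu hv]
    exact norm_integral_le_integral_norm _
  refine ⟨hext, hshift, ?_⟩
  set T : ℕ × ℕ × ℕ → ℂ := fun i =>
    SrivastavaHB.term (fun _ _ => 1) b₁ b₂ b₃ c₁ c₂ c₃ x y z i.1 i.2.1 i.2.2 with hT
  set G : ℕ × ℕ × ℕ → ℝ → ℂ := fun i p =>
    T i * ((p : ℂ) ^ (s - 1) • SrivastavaHB.extBeta p ν (b₁ + i.1 + i.2.2) (b₂ + i.1 + i.2.1))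
    with hG
  have hGe : ∀ i (p : ℝ), (p : ℂ) ^ (s - 1) *
      SrivastavaHB.extHBTerm (p : ℂ) ν b₁ b₂ b₃ c₁ c₂ c₃ x y z i = G i p := by
    intro i p
    rw [SrivastavaHB.extHBTerm, SrivastavaHB.term_eq_mul]
    simp only [hG, hT, smul_eq_mul]
    ring
  have hmel := fun i : ℕ × ℕ × ℕ => SrivastavaHB.hasMellin_extBeta hν hs
    (hp₁ i.1 i.2.2) (hp₂ i.1 i.2.1)
  have hGi : ∀ i, Integrable (G i) (volume.restrict (Set.Ioi 0)) := fun i =>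
    (hmel i).1.const_mul (T i)
  obtain ⟨N, hN, hNb⟩ := SrivastavaHB.exists_integral_norm_extBeta_le hν hs
  have hGs : Summable fun i => ∫ p in Set.Ioi (0 : ℝ), ‖G i p‖ := by
    -- Taking the uniform `L¹` bound itself as `F` reduces summability of the norms to the same
    -- triple-series criterion.
    have hβ := (hsummable (fun u v => ((N * ProbabilityTheory.beta (u + s).re (v + s).re : ℝ) : ℂ))
      N (fun u v hu hv => by
        rw [Complex.norm_real, Real.norm_of_nonneg
          (mul_nonneg hN (ProbabilityTheory.beta_pos hu hv).le)])).norm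
    refine hβ.of_nonneg_of_le (fun i => integral_nonneg fun _ => norm_nonneg _) fun i => ?_
    simp only [hG]
    simp_rw [norm_mul (T i)]
    rw [integral_const_mul, SrivastavaHB.term_eq_mul, norm_mul, Complex.norm_real,
      Real.norm_of_nonneg (mul_nonneg hN (ProbabilityTheory.beta_pos (hp₁ _ _) (hp₂ _ _)).le)]
    exact mul_le_mul_of_nonneg_left (hNb _ _ (hp₁ _ _) (hp₂ _ _)) (norm_nonneg _)
  have hpt : ∀ p ∈ Set.Ioi (0 : ℝ), Summable fun i => G i p := fun p hp => by
    simp_rw [← hGe]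
    exact (hext p hp).mul_left _
  -- No sign condition on `p` is needed: over a field `tsum_mul_left` holds without summability.
  have hsumG : ∀ p : ℝ, (p : ℂ) ^ (s - 1) •
      SrivastavaHB.extHB (p : ℂ) ν b₁ b₂ b₃ c₁ c₂ c₃ x y z = ∑' i, G i p := by
    intro p
    simp_rw [← hGe]
    rw [tsum_mul_left, SrivastavaHB.extHB, smul_eq_mul]
  constructor
  · rw [MellinConvergent]
    simp_rw [hsumG]
    exact SrivastavaHB.integrable_tsum_of_summable_integral_norm hGi hGs
      ((ae_restrict_iff' measurableSet_Ioi).2 (ae_of_all _ hpt))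
  · rw [mellin]
    simp_rw [hsumG]
    rw [← integral_tsum_of_summable_integral_norm hGi hGs, SrivastavaHB.shiftHB, ← tsum_mul_left]
    refine tsum_congr fun i => ?_
    have h := (hmel i).2
    rw [mellin] at h
    simp only [hG]
    rw [integral_const_mul, h, SrivastavaHB.shiftHBTerm, SrivastavaHB.term_eq_mul]
    ring
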